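/- Let $K$ be a finite (abstract) simplicial complex of dimension $2$ (not necessarily pure). Call a finite simplicial complex shellable if its facets (inclusion-maximal faces) can be listed without repetition as $F_1,\dots,F_t$ so that for every $k=2,\dots,t$ the subcomplex $\bigl(\bigcup_{i<k}\overline{F_i}\bigr)\cap\overline{F_k}$ is pure of dimension $\dim F_k-1$; here $\overline{F}$ is the complex of all subsets of $F$ (including $\emptyset$, of dimension $-1$), and a complex is pure of dimension $d$ if all its facets have dimension $d$. If $K$ is not shellable, then there are an integer $n$ with $4\le n\le 7$ and a set $U$ of $n$ vertices of $K$ such that the induced subcomplex $K(U)=\{F\in K : F\subseteq U\}$ is not shellable. -/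

import Mathlib

namespace PreAbstractSimplicialComplex

/-- The dimension `|F| - 1` of a simplex `F`, given by its vertices. The empty simplex has
dimension `-1`. -/
def simplexDim {V : Type*} (F : Finset V) : ℤ := (F.card : ℤ) - 1

/-- A family of simplices has dimension `d` if `d` is the largest dimension of its members. -/
def HasDim {V : Type*} (S : Set (Finset V)) (d : ℤ) : Prop :=
  IsGreatest (simplexDim '' S) d

/-- The facets of a family of simplices: the members that are maximal under inclusion. -/
def facets {V : Type*} (S : Set (Finset V)) : Set (Finset V) :=
  {F | Maximal (· ∈ S) F}

/-- A family of simplices is pure `d`-dimensional if it has dimension `d` and all of its facets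
have dimension `d`. -/
def IsPureOfDim {V : Type*} (S : Set (Finset V)) (d : ℤ) : Prop :=
  HasDim S d ∧ ∀ F ∈ facets S, simplexDim F = d

/-- The complex of all faces of a single simplex `F`, the empty face included. -/
def closedSimplex {V : Type*} (F : Finset V) : Set (Finset V) := {G | G ⊆ F}

/-- A (nonpure) shelling of `K`: an enumeration `F 0, F 1, …, F (t - 1)` of the facets of `K`
without repetition such that, for every `k ≥ 1`, the intersection of the complex generated by
`F k` with the complex generated by all earlier facets is pure of dimension `dim (F k) - 1`. -/
def IsShelling {V : Type*} (K : PreAbstractSimplicialComplex V) {t : ℕ}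
    (F : Fin t → Finset V) : Prop :=
  Function.Injective F ∧ Set.range F = facets K.faces ∧
    ∀ k : Fin t, 0 < (k : ℕ) →
      IsPureOfDim ((⋃ i : Fin t, ⋃ _ : i < k, closedSimplex (F i)) ∩ closedSimplex (F k))
        (simplexDim (F k) - 1)

/-- `K` is shellable, in the general (nonpure) sense, if it has a shelling. -/
def Shellable {V : Type*} (K : PreAbstractSimplicialComplex V) : Prop :=
  ∃ (t : ℕ) (F : Fin t → Finset V), K.IsShelling F

/-- The vertex set of `K`. -/
def vertexSet {V : Type*} (K : PreAbstractSimplicialComplex V) : Set V := {v | {v} ∈ K.faces}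

/-- The subcomplex `K(U)` of `K` induced by a set `U`: all faces of `K` contained in `U`. -/
def induced {V : Type*} (K : PreAbstractSimplicialComplex V) (U : Finset V) :
    PreAbstractSimplicialComplex V where
  faces := {F | F ∈ K.faces ∧ F ⊆ U}
  isRelLowerSet_faces := fun _ hF =>
    ⟨(K.isRelLowerSet_faces hF.1).1, fun _ hGF hG =>
      ⟨(K.isRelLowerSet_faces hF.1).2 hGF hG, hGF.trans hF.2⟩⟩

end PreAbstractSimplicialComplex

/-! In dimension two, shellability is governed by conditions that small vertex sets detect. Facets
can be listed by decreasing dimension, so it suffices to shell the triangles and to know that the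
edges form a connected graph (`shellable_of_triangles`).

A shellable family of triangles is connected, has connected vertex links and has no first cohomology
(`color_eq`, `link_color_eq`, `exists_potential`). Conversely, the triangles at a vertex v can be
appended to a shelling of the others if the link of v is connected and meets the old triangles in a
connected, nonempty set (`of_filter_notMem`). Deleting vertices one after another, `of_restrict`
thus shells all triangles.

The delicate condition is that this intersection is connected. It follows in the manner of
Mayer–Vietoris: the star of v and the old part are connected, and the union has no first cohomology.
To join two vertices of the intersection, take old triangles B and D through them, each containing a
link edge at that vertex, and argue inside {v} ∪ B ∪ D. This is where 7 = 1 + 3 + 3 comes from. The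
lower bound 4 costs nothing: three vertices carry at most one triangle, and edges in different
components span at least four vertices. -/

/-- A finite family of sets that can be listed so that every member `F` meets the union of the
simplices listed before it in a union of faces of codimension one in `F`. -/
inductive Shells {V : Type*} [DecidableEq V] : Finset (Finset V) → Prop
  | empty : Shells ∅
  | cons {S : Finset (Finset V)} {F : Finset V} : Shells S → F ∉ S →
      (∀ G ∈ S, ∃ G' ∈ S, G ∩ F ⊆ G' ∧ (G' ∩ F).card + 1 = F.card) → Shells (insert F S)

/-! ### Consequences of shellability: connectedness, connected links, vanishing first cohomology. -/

namespace Shells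

variable {V : Type*} [DecidableEq V]

/-- The members of size at least `k` of a shellable antichain form a shellable family. -/
theorem filter_card {S : Finset (Finset V)} (h : Shells S)
    (hS : IsAntichain (· ⊆ ·) (S : Set (Finset V))) (k : ℕ) :
    Shells (S.filter (fun F => k ≤ F.card)) := by
  induction h with
  | empty => simpa using Shells.empty
  | @cons S F _ hF hatt ih =>
    have ih' := ih (hS.subset (by simp))
    rw [Finset.filter_insert]
    split_ifs with hk
    · refine Shells.cons ih' (by simp [hF]) ?_
      intro G hG
      obtain ⟨G', hG', hsub, hcard⟩ := hatt G (Finset.mem_filter.1 hG).1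
      refine ⟨G', Finset.mem_filter.2 ⟨hG', ?_⟩, hsub, hcard⟩
      -- `G'` contains all but one vertex of `F` and also a vertex outside `F`, so it is at least as
      -- large as `F` and survives the filter.
      have hne : ¬ G' ⊆ F := hS (by simp [hG']) (by simp) (fun e => hF (e ▸ hG'))
      have hlt : (G' ∩ F).card < G'.card :=
        Finset.card_lt_card (Finset.ssubset_iff_subset_ne.2 ⟨Finset.inter_subset_left,
          fun e => hne (Finset.inter_eq_left.1 e)⟩)
      omega
    · exact ih'

/-- A colouring constant on each member of a shellable family without singletons is constant. -/
theorem color_eq {S : Finset (Finset V)} (h : Shells S) (p : V → Prop)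
    (hcard : ∀ F ∈ S, 2 ≤ F.card) (hp : ∀ F ∈ S, ∀ x ∈ F, ∀ y ∈ F, (p x ↔ p y)) :
    ∀ F ∈ S, ∀ G ∈ S, ∀ x ∈ F, ∀ y ∈ G, (p x ↔ p y) := by
  induction h with
  | empty => simp
  | @cons S F _ hF hatt ih =>
    have ih' := ih (fun G hG => hcard G (by simp [hG])) (fun G hG => hp G (by simp [hG]))
    have key : ∀ G ∈ S, ∀ x ∈ F, ∀ y ∈ G, (p x ↔ p y) := by
      intro G hG x hx y hy
      obtain ⟨G', hG', -, hc⟩ := hatt G hG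
      have h2 := hcard F (by simp)
      obtain ⟨z, hz⟩ : (G' ∩ F).Nonempty := Finset.card_pos.1 (by omega)
      rw [Finset.mem_inter] at hz
      exact (hp F (by simp) x hx z hz.2).trans (ih' G' hG' G hG z hz.1 y hy)
    intro A hA B hB x hx y hy
    rcases Finset.mem_insert.1 hA with rfl | hA' <;> rcases Finset.mem_insert.1 hB with rfl | hB'
    · exact hp _ (by simp) x hx y hy
    · exact key B hB' x hx y hy
    · exact (key A hA' y hy x hx).symm
    · exact ih' A hA' B hB' x hx y hy

/-- The vertex links of a shellable family of triangles are connected. -/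
theorem link_color_eq {S : Finset (Finset V)} (h : Shells S) (v : V) (p : V → Prop)
    (hcard : ∀ F ∈ S, F.card = 3)
    (hp : ∀ F ∈ S, v ∈ F → ∀ x ∈ F, ∀ y ∈ F, x ≠ v → y ≠ v → (p x ↔ p y)) :
    ∀ F ∈ S, ∀ G ∈ S, v ∈ F → v ∈ G → ∀ x ∈ F, ∀ y ∈ G, x ≠ v → y ≠ v → (p x ↔ p y) := by
  induction h with
  | empty => simp
  | @cons S F _ hF hatt ih =>
    have ih' := ih (fun G hG => hcard G (by simp [hG])) (fun G hG => hp G (by simp [hG]))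
    have key : ∀ G ∈ S, v ∈ F → v ∈ G → ∀ x ∈ F, ∀ y ∈ G, x ≠ v → y ≠ v → (p x ↔ p y) := by
      intro G hG hvF hvG x hx y hy hxv hyv
      obtain ⟨G', hG', hsub, hc⟩ := hatt G hG
      have h3 := hcard F (by simp)
      -- `G'` contains `G ∩ F`, hence `v`, and shares an edge with `F`; the other end of that edge
      -- links `F` to the old part of the link.
      obtain ⟨z, hz, hzv⟩ : ∃ z ∈ G' ∩ F, z ≠ v :=
        Finset.exists_mem_ne (by omega) v
      rw [Finset.mem_inter] at hz
      exact (hp F (by simp) hvF x hx z hz.2 hxv hzv).trans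
        (ih' G' hG' G hG (hsub (by simp [hvF, hvG])) hvG z hz.1 y hy hzv hyv)
    intro A hA B hB hvA hvB x hx y hy hxv hyv
    rcases Finset.mem_insert.1 hA with rfl | hA' <;> rcases Finset.mem_insert.1 hB with rfl | hB'
    · exact hp _ (by simp) hvA x hx y hy hxv hyv
    · exact key B hB' hvA hvB x hx y hy hxv hyv
    · exact (key A hA' hvB hvA y hy x hx hyv hxv).symm
    · exact ih' A hA' B hB' hvA hvB x hx y hy hxv hyv

/-- On a shellable family of triangles, potentials of the triangles with equal differences on
common edges come from a global potential: the first cohomology vanishes. -/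
theorem exists_potential {S : Finset (Finset V)} (h : Shells S) (φ : Finset V → V → ℤ)
    (hcard : ∀ F ∈ S, F.card = 3)
    (hφ : ∀ F ∈ S, ∀ G ∈ S, ∀ x ∈ F ∩ G, ∀ y ∈ F ∩ G, φ F x - φ F y = φ G x - φ G y) :
    ∃ g : V → ℤ, ∀ F ∈ S, ∀ x ∈ F, ∀ y ∈ F, g x - g y = φ F x - φ F y := by
  induction h with
  | empty => exact ⟨0, by simp⟩
  | @cons S F _ hF hatt ih =>
    obtain ⟨g, hg⟩ := ih (fun G hG => hcard G (by simp [hG]))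
      (fun G hG G' hG' => hφ G (by simp [hG]) G' (by simp [hG']))
    rcases S.eq_empty_or_nonempty with rfl | ⟨G₀, hG₀⟩
    · refine ⟨φ F, ?_⟩
      simp
    obtain ⟨G, hG, -, hGc⟩ := hatt G₀ hG₀
    have h3 := hcard F (by simp)
    have hex : (F \ G).card = 1 := by
      have := Finset.card_sdiff_add_card_inter F G
      rw [Finset.inter_comm] at this
      omega
    obtain ⟨c, hc⟩ := Finset.card_eq_one.1 hex
    obtain ⟨a, ha⟩ : (G ∩ F).Nonempty := Finset.card_pos.1 (by omega)
    rw [Finset.mem_inter] at ha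
    have hcF : c ∈ F ∧ c ∉ G := Finset.mem_sdiff.1 (by simp [hc])
    have hgG : ∀ H ∈ S, ∀ x ∈ F, ∀ y ∈ F, x ∈ H → y ∈ H → g x - g y = φ F x - φ F y := by
      intro H hH x hx y hy hxH hyH
      rw [hg H hH x hxH y hyH]
      exact hφ H (by simp [hH]) F (by simp) x (by simp [hx, hxH]) y (by simp [hy, hyH])
    have hother : ∀ x ∈ F, x ≠ c → x ∈ G := by
      intro x hx hxc
      by_contra hxG
      have : x ∈ F \ G := Finset.mem_sdiff.2 ⟨hx, hxG⟩
      rw [hc] at this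
      exact hxc (Finset.mem_singleton.1 this)
    -- If the vertex `c` opposite the edge shared with `G` is old, the shelling gives a second
    -- shared edge, through `c`; two edges of `F` determine all differences, so `g` already fits. If
    -- `c` is new, its value can be prescribed.
    by_cases hcS : ∃ H ∈ S, c ∈ H
    · obtain ⟨H, hH, hcH⟩ := hcS
      obtain ⟨H', hH', hsub, hH'c⟩ := hatt H hH
      have hcH' : c ∈ H' := hsub (by simp [hcF.1, hcH])
      obtain ⟨b, hb, hbc⟩ : ∃ b ∈ H' ∩ F, b ≠ c := Finset.exists_mem_ne (by omega) c
      rw [Finset.mem_inter] at hb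
      have hbase : ∀ x ∈ F, g x - g b = φ F x - φ F b := by
        intro x hx
        by_cases hxc : x = c
        · subst hxc
          exact hgG H' hH' x hx b hb.2 hcH' hb.1
        · exact hgG G hG x hx b hb.2 (hother x hx hxc) (hother b hb.2 hbc)
      refine ⟨g, ?_⟩
      intro A hA x hx y hy
      rcases Finset.mem_insert.1 hA with rfl | hA'
      · have := hbase x hx
        have := hbase y hy
        linarith
      · exact hg A hA' x hx y hy
    · push Not at hcS
      have hac : a ≠ c := fun e => hcF.2 (e ▸ ha.1)
      refine ⟨Function.update g c (g a + (φ F c - φ F a)), ?_⟩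
      intro A hA x hx y hy
      rcases Finset.mem_insert.1 hA with rfl | hA'
      · have hbase : ∀ x ∈ A, Function.update g c (g a + (φ A c - φ A a)) x - g a
            = φ A x - φ A a := by
          intro x hx
          by_cases hxc : x = c
          · subst hxc
            simp
          · rw [Function.update_of_ne hxc]
            exact hgG G hG x hx a ha.2 (hother x hx hxc) ha.1
        have := hbase x hx
        have := hbase y hy
        linarith
      · have hxc : x ≠ c := fun e => hcS A hA' (e ▸ hx)
        have hyc : y ≠ c := fun e => hcS A hA' (e ▸ hy)
        rw [Function.update_of_ne hxc, Function.update_of_ne hyc]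
        exact hg A hA' x hx y hy

/-- If every partial shelling between `S` and `T` can be continued, `T` is shellable. -/
theorem of_forall_exists {S T : Finset (Finset V)} (hS : Shells S) (hST : S ⊆ T)
    (hext : ∀ R, S ⊆ R → R ⊆ T → R ≠ T → Shells R → ∃ F ∈ T, F ∉ R ∧
      ∀ G ∈ R, ∃ G' ∈ R, G ∩ F ⊆ G' ∧ (G' ∩ F).card + 1 = F.card) : Shells T := by
  induction hn : (T \ S).card generalizing S with
  | zero =>
    have : T ⊆ S := Finset.sdiff_eq_empty_iff_subset.1 (Finset.card_eq_zero.1 hn)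
    exact (this.antisymm hST) ▸ hS
  | succ n ih =>
    have hne : S ≠ T := by
      rintro rfl
      simp at hn
    obtain ⟨F, hFT, hFS, hF⟩ := hext S subset_rfl hST hne hS
    refine ih (hS.cons hFS hF) (Finset.insert_subset hFT hST)
      (fun R hR => hext R ((Finset.subset_insert _ _).trans hR)) ?_
    rw [Finset.sdiff_insert, Finset.card_erase_of_mem (Finset.mem_sdiff.2 ⟨hFT, hFS⟩), hn,
      Nat.add_sub_cancel]

end Shells

/-! ### Families of triangles: appending the star of a vertex, and the local-to-global criterion. -/

namespace Shells

variable {V : Type*} [DecidableEq V]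

theorem pair_subset {s : Finset V} {x y : V} (hx : x ∈ s) (hy : y ∈ s) : ({x, y} : Finset V) ⊆ s :=
  Finset.insert_subset hx (Finset.singleton_subset_iff.2 hy)

theorem erase_eq_pair {F : Finset V} (hF : F.card = 3) {v x y : V} (hv : v ∈ F) (hx : x ∈ F)
    (hy : y ∈ F) (hxv : x ≠ v) (hyv : y ≠ v) (hxy : x ≠ y) : F.erase v = {x, y} := by
  refine (Finset.eq_of_subset_of_card_le (pair_subset (Finset.mem_erase.2 ⟨hxv, hx⟩)
    (Finset.mem_erase.2 ⟨hyv, hy⟩)) ?_).symm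
  rw [Finset.card_pair hxy, Finset.card_erase_of_mem hv, hF]

/-- The triangles of a family with all vertices in a given set of at most three vertices form a
shellable family. -/
theorem filter_subset_of_card_le {T : Finset (Finset V)} (hcard : ∀ F ∈ T, F.card = 3)
    {U : Finset V} (hU : U.card ≤ 3) : Shells (T.filter (· ⊆ U)) := by
  have hsub : T.filter (· ⊆ U) ⊆ {U} := by
    intro F hF
    rw [Finset.mem_filter] at hF
    exact Finset.mem_singleton.2
      (Finset.eq_of_subset_of_card_le hF.2 (by rw [hcard F hF.1]; exact hU))
  rcases Finset.subset_singleton_iff.1 hsub with h | h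
  · rw [h]
    exact Shells.empty
  · rw [h]
    simpa using Shells.cons (F := U) Shells.empty (by simp) (by simp)

/-- Adding to a shellable family the triangles at a new vertex `v` keeps it shellable if the link
of `v` is connected, as well as its intersection with the old family. -/
theorem of_filter_notMem {T : Finset (Finset V)} (hcard : ∀ F ∈ T, F.card = 3) (v : V)
    (hold : Shells (T.filter (v ∉ ·)))
    (hlink : ∀ p : V → Prop,
      (∀ F ∈ T, v ∈ F → ∀ x ∈ F, ∀ y ∈ F, x ≠ v → y ≠ v → (p x ↔ p y)) →
      ∀ F ∈ T, ∀ G ∈ T, v ∈ F → v ∈ G → ∀ x ∈ F, ∀ y ∈ G, x ≠ v → y ≠ v → (p x ↔ p y))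
    (hinter : ∀ p : V → Prop,
      (∀ F ∈ T, ∀ G ∈ T, v ∈ F → v ∉ G → F.erase v ⊆ G →
        ∀ x ∈ F.erase v, ∀ y ∈ F.erase v, (p x ↔ p y)) →
      ∀ F ∈ T, ∀ F' ∈ T, ∀ G ∈ T, ∀ G' ∈ T, v ∈ F → v ∈ F' → v ∉ G → v ∉ G' →
        ∀ x ∈ F.erase v ∩ G, ∀ y ∈ F'.erase v ∩ G', (p x ↔ p y))
    (hne : ∀ G ∈ T, v ∉ G → ∃ F ∈ T, v ∈ F ∧ ∃ G' ∈ T, v ∉ G' ∧ F.erase v ⊆ G') :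
    Shells T := by
  classical
  set T₀ := T.filter (v ∉ ·) with hT₀
  -- The triangles at `v` are added in two rounds: first those whose edge opposite `v` lies in an
  -- old triangle, then the rest.
  set T₁ := T.filter (fun F => v ∈ F → ∃ G ∈ T, v ∉ G ∧ F.erase v ⊆ G) with hT₁
  have memT₀ : ∀ F, F ∈ T₀ ↔ F ∈ T ∧ v ∉ F := fun F => by simp [hT₀]
  have memT₁ : ∀ F, F ∈ T₁ ↔ F ∈ T ∧ (v ∈ F → ∃ G ∈ T, v ∉ G ∧ F.erase v ⊆ G) :=
    fun F => by rw [hT₁, Finset.mem_filter]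
  have h01 : T₀ ⊆ T₁ := fun F hF =>
    (memT₁ F).2 ⟨((memT₀ F).1 hF).1, fun h => absurd h ((memT₀ F).1 hF).2⟩
  -- two distinct triangles sharing two vertices share exactly two
  have hcard2 : ∀ F ∈ T, ∀ G ∈ T, F ≠ G → ∀ x y, x ≠ y → x ∈ F → y ∈ F → x ∈ G → y ∈ G →
      (G ∩ F).card + 1 = F.card := by
    intro F hF G hG hFG x y hxy hxF hyF hxG hyG
    have h1 : ({x, y} : Finset V) ⊆ G ∩ F :=
      pair_subset (Finset.mem_inter.2 ⟨hxG, hxF⟩) (Finset.mem_inter.2 ⟨hyG, hyF⟩)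
    have h2 := Finset.card_le_card h1
    rw [Finset.card_pair hxy] at h2
    have h3 : (G ∩ F).card ≤ F.card := Finset.card_le_card Finset.inter_subset_right
    have h4 : (G ∩ F).card ≠ 3 := by
      intro h
      have e1 : G ∩ F = F :=
        Finset.eq_of_subset_of_card_le Finset.inter_subset_right (by rw [h, hcard F hF])
      have e2 : G ∩ F = G :=
        Finset.eq_of_subset_of_card_le Finset.inter_subset_left (by rw [h, hcard G hG])
      exact hFG (e1.symm.trans e2)
    have := hcard F hF
    omega
  have hother : ∀ F ∈ T, v ∈ F → ∀ x ∈ F, x ≠ v → ∃ y ∈ F, y ≠ v ∧ y ≠ x ∧ F = {v, x, y} := by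
    intro F hF hv x hx hxv
    have hc : ((F.erase v).erase x).card = 1 := by
      rw [Finset.card_erase_of_mem (by simp [hx, hxv]), Finset.card_erase_of_mem hv, hcard F hF]
    obtain ⟨y, hy⟩ := Finset.card_eq_one.1 hc
    have hy' : y ∈ (F.erase v).erase x := by simp [hy]
    simp only [Finset.mem_erase] at hy'
    refine ⟨y, hy'.2.2, hy'.2.1, hy'.1, ?_⟩
    rw [← hy, Finset.insert_erase (by simp [hx, hxv]), Finset.insert_erase hv]
  have h1 : Shells T₁ := by
    refine of_forall_exists hold h01 ?_
    intro R hR0 hR1 hRne hR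
    by_contra hno
    push Not at hno
    have hRT : ∀ G ∈ R, G ∈ T := fun G hG => ((memT₁ G).1 (hR1 hG)).1
    -- the vertices of the link of `v` in `R`
    set p : V → Prop := fun x => ∃ G ∈ R, v ∈ G ∧ x ∈ G with hp
    -- Such an `F` meets the old family in its opposite edge plus possibly `v`, so it can be added
    -- once `v` is covered by an edge, or while no triangle at `v` is present. The second
    -- alternative starts the round.
    have hstep : ∀ F ∈ T₁, v ∈ F → ∀ x ∈ F, x ≠ v → (p x ∨ ∀ G ∈ R, v ∉ G) → F ∈ R := by
      intro F hF hvF x hx hxv hpx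
      by_contra hFR
      obtain ⟨G, hG, hGno⟩ := hno F hF hFR
      obtain ⟨hFT, hFG⟩ := (memT₁ F).1 hF
      obtain ⟨G₁, hG₁T, hvG₁, hFG₁⟩ := hFG hvF
      have hG₁ : G₁ ∈ R := hR0 ((memT₀ G₁).2 ⟨hG₁T, hvG₁⟩)
      obtain ⟨y, hy, hyv, hyx, hFe⟩ := hother F hFT hvF x hx hxv
      by_cases hvG : v ∈ G
      · rcases hpx with ⟨G₂, hG₂, hvG₂, hxG₂⟩ | hnone
        · by_cases hyG : y ∈ G
          · exact hGno G hG Finset.inter_subset_left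
              (hcard2 F hFT G (hRT G hG) (by rintro rfl; exact hFR hG) v y hyv.symm hvF hy hvG hyG)
          · refine hGno G₂ hG₂ ?_
              (hcard2 F hFT G₂ (hRT _ hG₂) (by rintro rfl; exact hFR hG₂) v x hxv.symm hvF hx
                hvG₂ hxG₂)
            intro z hz
            rw [hFe] at hz
            simp only [Finset.mem_inter, Finset.mem_insert, Finset.mem_singleton] at hz
            rcases hz with ⟨hzG, rfl | rfl | rfl⟩
            · exact hvG₂
            · exact hxG₂
            · exact absurd hzG hyG
        · exact hnone G hG hvG
      · refine hGno G₁ hG₁ ?_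
          (hcard2 F hFT G₁ hG₁T (by rintro rfl; exact hvG₁ hvF) x y hyx.symm hx hy
            (hFG₁ (by simp [hx, hxv])) (hFG₁ (by simp [hy, hyv])))
        intro z hz
        rw [Finset.mem_inter] at hz
        exact hFG₁ (Finset.mem_erase.2 ⟨fun e => hvG (e ▸ hz.1), hz.2⟩)
    obtain ⟨F, hF, hFR⟩ := Finset.not_subset.1 fun h => hRne (hR1.antisymm h)
    obtain ⟨hFT, hFG⟩ := (memT₁ F).1 hF
    have hvF : v ∈ F := by
      by_contra hvF
      exact hFR (hR0 ((memT₀ F).2 ⟨hFT, hvF⟩))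
    obtain ⟨x, hx, hxv⟩ : ∃ x ∈ F, x ≠ v := Finset.exists_mem_ne (by rw [hcard F hFT]; norm_num) v
    obtain ⟨G₁, hG₁T, hvG₁, hFG₁⟩ := hFG hvF
    have hnone : ¬ ∀ G ∈ R, v ∉ G := fun hn => hFR (hstep F hF hvF x hx hxv (Or.inr hn))
    push Not at hnone
    obtain ⟨A, hA, hvA⟩ := hnone
    obtain ⟨hAT, hAG⟩ := (memT₁ A).1 (hR1 hA)
    obtain ⟨G₂, hG₂T, hvG₂, hAG₂⟩ := hAG hvA
    obtain ⟨a, ha, hav⟩ : ∃ x ∈ A, x ≠ v := Finset.exists_mem_ne (by rw [hcard A hAT]; norm_num) v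
    have hpax := hinter p (by
      intro B hB G hG hvB hvG hBG y hy z hz
      rw [Finset.mem_erase] at hy hz
      have hB1 : B ∈ T₁ := (memT₁ B).2 ⟨hB, fun _ => ⟨G, hG, hvG, hBG⟩⟩
      exact ⟨fun h => ⟨B, hstep B hB1 hvB y hy.2 hy.1 (Or.inl h), hvB, hz.2⟩,
        fun h => ⟨B, hstep B hB1 hvB z hz.2 hz.1 (Or.inl h), hvB, hy.2⟩⟩)
      A hAT F hFT G₂ hG₂T G₁ hG₁T hvA hvF hvG₂ hvG₁ a
      (by simp [ha, hav, hAG₂ (Finset.mem_erase.2 ⟨hav, ha⟩)]) x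
      (by simp [hx, hxv, hFG₁ (Finset.mem_erase.2 ⟨hxv, hx⟩)])
    exact hFR (hstep F hF hvF x hx hxv (Or.inl (hpax.1 ⟨A, hA, hvA, ha⟩)))
  refine of_forall_exists h1 (Finset.filter_subset _ _) ?_
  intro R hR1 hRT hRne hR
  by_contra hno
  push Not at hno
  set p : V → Prop := fun x => ∃ G ∈ R, v ∈ G ∧ x ∈ G with hp
  obtain ⟨F, hFT, hFR⟩ := Finset.not_subset.1 fun h => hRne (hRT.antisymm h)
  have hmem : ∀ F ∈ T, F ∉ R → v ∈ F := by
    intro F hFT hFR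
    by_contra hvF
    exact hFR (hR1 (h01 ((memT₀ F).2 ⟨hFT, hvF⟩)))
  have hvF := hmem F hFT hFR
  obtain ⟨x, hx, hxv⟩ : ∃ x ∈ F, x ≠ v := Finset.exists_mem_ne (by rw [hcard F hFT]; norm_num) v
  obtain ⟨A, hA, hvA⟩ : ∃ A ∈ R, v ∈ A := by
    by_contra hnone
    push Not at hnone
    obtain ⟨G, hG, -⟩ := hno F hFT hFR
    obtain ⟨A, hA, hvA, G', hG', hvG', hAG'⟩ := hne G (hRT hG) (hnone G hG)
    exact hnone A (hR1 ((memT₁ A).2 ⟨hA, fun _ => ⟨G', hG', hvG', hAG'⟩⟩)) hvA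
  -- In the second round the opposite edge of `F` is in no old triangle, so `F` has to meet `R` in
  -- edges through `v`.
  have hstep : ∀ F ∈ T, v ∈ F → ∀ x ∈ F, x ≠ v → p x → F ∈ R := by
    intro F hFT hvF x hx hxv hpx
    by_contra hFR
    obtain ⟨G, hG, hGno⟩ := hno F hFT hFR
    obtain ⟨y, hy, hyv, hyx, hFe⟩ := hother F hFT hvF x hx hxv
    have hedge : ∀ H ∈ R, v ∈ H → ∀ z ∈ F, z ≠ v → z ∈ H → ¬ (∀ w ∈ G ∩ F, w = v ∨ w = z) := by
      intro H hH hvH z hz hzv hzH hall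
      refine hGno H hH ?_ (hcard2 F hFT H (hRT hH) (by rintro rfl; exact hFR hH) v z hzv.symm hvF hz
        hvH hzH)
      intro w hw
      rcases hall w hw with rfl | rfl
      · exact hvH
      · exact hzH
    have hwF : ∀ w ∈ G ∩ F, w ∈ G ∧ (w = v ∨ w = x ∨ w = y) := by
      intro w hw
      rw [hFe] at hw
      simpa using hw
    obtain ⟨B, hB, hvB, hxB⟩ := hpx
    by_cases hyG : y ∈ G
    · by_cases hvG : v ∈ G
      · exact hGno G hG Finset.inter_subset_left
          (hcard2 F hFT G (hRT hG) (by rintro rfl; exact hFR hG) v y hyv.symm hvF hy hvG hyG)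
      · by_cases hxG : x ∈ G
        · refine hFR (hR1 ((memT₁ F).2 ⟨hFT, fun _ => ⟨G, hRT hG, hvG, ?_⟩⟩))
          intro w hw
          rw [hFe] at hw
          simp only [Finset.mem_erase, Finset.mem_insert, Finset.mem_singleton] at hw
          rcases hw with ⟨hwv, rfl | rfl | rfl⟩
          · exact absurd rfl hwv
          · exact hxG
          · exact hyG
        -- Here `y` is on an old triangle, so connectedness of the intersection puts it on a
        -- triangle of the first round; the edge from `v` to `y` is then covered by `R`.
        · obtain ⟨C, hC, hvC, G', hG', hvG', hCG'⟩ := hne G (hRT hG) hvG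
          have hCR : C ∈ R := hR1 ((memT₁ C).2 ⟨hC, fun _ => ⟨G', hG', hvG', hCG'⟩⟩)
          obtain ⟨c, hc, hcv⟩ : ∃ x ∈ C, x ≠ v :=
            Finset.exists_mem_ne (by rw [hcard C hC]; norm_num) v
          obtain ⟨D, hD, hvD, hyD⟩ : p y := (hinter p (by
            intro B hB G hG hvB hvG hBG y hy z hz
            rw [Finset.mem_erase] at hy hz
            have hBR : B ∈ R := hR1 ((memT₁ B).2 ⟨hB, fun _ => ⟨G, hG, hvG, hBG⟩⟩)
            exact ⟨fun _ => ⟨B, hBR, hvB, hz.2⟩, fun _ => ⟨B, hBR, hvB, hy.2⟩⟩)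
            C hC F hFT G' hG' G (hRT hG) hvC hvF hvG' hvG c
            (by simp [hc, hcv, hCG' (Finset.mem_erase.2 ⟨hcv, hc⟩)]) y
            (by simp [hy, hyv, hyG])).1 ⟨C, hCR, hvC, hc⟩
          refine hedge D hD hvD y hy hyv hyD ?_
          intro w hw
          rcases hwF w hw with ⟨hwG, rfl | rfl | rfl⟩
          · exact Or.inl rfl
          · exact absurd hwG hxG
          · exact Or.inr rfl
    · refine hedge B hB hvB x hx hxv hxB ?_
      intro w hw
      rcases hwF w hw with ⟨hwG, rfl | rfl | rfl⟩
      · exact Or.inl rfl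
      · exact Or.inr rfl
      · exact absurd hwG hyG
  obtain ⟨a, ha, hav⟩ : ∃ x ∈ A, x ≠ v :=
    Finset.exists_mem_ne (by rw [hcard A (hRT hA)]; norm_num) v
  have hpax := hlink p (by
    intro B hB hvB y hy z hz hyv hzv
    exact ⟨fun h => ⟨B, hstep B hB hvB y hy hyv h, hvB, hz⟩,
      fun h => ⟨B, hstep B hB hvB z hz hzv h, hvB, hy⟩⟩)
    A (hRT hA) F hFT hvA hvF a ha x hx hav hxv
  exact hFR (hstep F hFT hvF x hx hxv (hpax.1 ⟨A, hA, hvA, ha⟩))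

/-- A family of triangles is shellable if its restrictions to sets of at most seven vertices
are. -/
theorem of_restrict {T : Finset (Finset V)} (hcard : ∀ F ∈ T, F.card = 3)
    (hT : ∀ U : Finset V, U.card ≤ 7 → Shells (T.filter (· ⊆ U))) : Shells T := by
  induction hn : T.card using Nat.strong_induction_on generalizing T with
  | _ n ih =>
  rcases T.eq_empty_or_nonempty with rfl | ⟨F₀, hF₀⟩
  · exact Shells.empty
  have h3 : ∀ U, ∀ F ∈ T.filter (· ⊆ U), F.card = 3 := fun U F hF =>
    hcard F (Finset.mem_filter.1 hF).1
  have hlink : ∀ (v : V) (p : V → Prop),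
      (∀ F ∈ T, v ∈ F → ∀ x ∈ F, ∀ y ∈ F, x ≠ v → y ≠ v → (p x ↔ p y)) →
      ∀ F ∈ T, ∀ G ∈ T, v ∈ F → v ∈ G → ∀ x ∈ F, ∀ y ∈ G, x ≠ v → y ≠ v → (p x ↔ p y) := by
    intro v p hp F hF G hG
    refine link_color_eq (hT (F ∪ G) ?_) v p (h3 _)
      (fun A hA => hp A (Finset.mem_filter.1 hA).1) F (by simp [hF]) G (by simp [hG])
    have := Finset.card_union_le F G
    rw [hcard F hF, hcard G hG] at this
    omega
  have hconn : ∀ p : V → Prop, (∀ F ∈ T, ∀ x ∈ F, ∀ y ∈ F, (p x ↔ p y)) →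
      ∀ F ∈ T, ∀ G ∈ T, ∀ x ∈ F, ∀ y ∈ G, (p x ↔ p y) := by
    intro p hp F hF G hG
    refine color_eq (hT (F ∪ G) ?_) p (fun A hA => by rw [h3 _ A hA]; norm_num)
      (fun A hA => hp A (Finset.mem_filter.1 hA).1) F (by simp [hF]) G (by simp [hG])
    have := Finset.card_union_le F G
    rw [hcard F hF, hcard G hG] at this
    omega
  obtain ⟨v, hv⟩ : F₀.Nonempty := Finset.card_pos.1 (by rw [hcard F₀ hF₀]; norm_num)
  have hnonisol : ∀ A ∈ T, ∀ B ∈ T, ∀ a ∈ A, a ∈ B → v ∈ A → v ∉ B →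
      ∃ F ∈ T, v ∈ F ∧ a ∈ F ∧ ∃ G ∈ T, v ∉ G ∧ F.erase v ⊆ G := by
    intro A hA B hB a haA haB hvA hvB
    by_contra hno
    push Not at hno
    have hav : a ≠ v := fun e => hvB (e ▸ haB)
    -- In the link of `a`, mark the vertices on a triangle through `a` and `v`. Without a crossing
    -- from such triangles to those missing `v`, the mark is constant along link edges, so
    -- connectedness of the link spreads it from `v` to `B`.
    have hcl : ∀ F ∈ T, a ∈ F → ∀ x ∈ F, ∀ y ∈ F, x ≠ a → y ≠ a →
        (∃ E ∈ T, a ∈ E ∧ v ∈ E ∧ x ∈ E) → (∃ E ∈ T, a ∈ E ∧ v ∈ E ∧ y ∈ E) := by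
      rintro F hF haF x hx y hy hxa hya ⟨E, hE, haE, hvE, hxE⟩
      by_cases hvF : v ∈ F
      · exact ⟨F, hF, haF, hvF, hy⟩
      · exfalso
        refine hno E hE hvE haE F hF hvF ?_
        have hxv : x ≠ v := fun e => hvF (e ▸ hx)
        rw [erase_eq_pair (hcard E hE) hvE haE hxE hav hxv hxa.symm]
        exact pair_subset haF hx
    obtain ⟨b, hb, hba⟩ : ∃ b ∈ B, b ≠ a := Finset.exists_mem_ne (by rw [hcard B hB]; norm_num) a
    have := (hlink a (fun x => ∃ E ∈ T, a ∈ E ∧ v ∈ E ∧ x ∈ E)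
      (fun F hF haF x hx y hy hxa hya =>
        ⟨hcl F hF haF x hx y hy hxa hya, hcl F hF haF y hy x hx hya hxa⟩)
      A hA B hB haA haB v hvA b hb hav.symm hba).1 ⟨A, hA, haA, hvA, hvA⟩
    obtain ⟨E, hE, haE, hvE, hbE⟩ := this
    have hbv : b ≠ v := fun e => hvB (e ▸ hb)
    refine hno E hE hvE haE B hB hvB ?_
    rw [erase_eq_pair (hcard E hE) hvE haE hbE hav hbv hba.symm]
    exact pair_subset haB hb
  refine of_filter_notMem hcard v ?_ (hlink v) ?_ ?_
  · refine ih _ ?_ (T := T.filter (v ∉ ·)) (fun F hF => hcard F (Finset.mem_filter.1 hF).1) ?_ rfl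
    · rw [← hn]
      exact Finset.card_lt_card (Finset.filter_ssubset.2 ⟨F₀, hF₀, by simpa using hv⟩)
    · intro U hU
      have : (T.filter (v ∉ ·)).filter (· ⊆ U) = T.filter (· ⊆ U.erase v) := by
        ext F
        simp only [Finset.mem_filter, Finset.subset_erase]
        tauto
      rw [this]
      exact hT _ ((Finset.card_erase_le).trans hU)
  · intro p hp A' hA' C' hC' B' hB' D' hD' hvA' hvC' hvB' hvD' a ha c hc
    simp only [Finset.mem_inter, Finset.mem_erase] at ha hc
    obtain ⟨A, hA, hvA, haA, B, hB, hvB, hAB⟩ :=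
      hnonisol A' hA' B' hB' a ha.1.2 ha.2 hvA' hvB'
    obtain ⟨C, hC, hvC, hcC, D, hD, hvD, hCD⟩ :=
      hnonisol C' hC' D' hD' c hc.1.2 hc.2 hvC' hvD'
    have hBD : (B ∪ D).card ≤ 6 := by
      have := Finset.card_union_le B D
      rw [hcard B hB, hcard D hD] at this
      omega
    have hAU : A ⊆ insert v (B ∪ D) := by
      intro z hz
      by_cases hzv : z = v
      · simp [hzv]
      · simp [hAB (Finset.mem_erase.2 ⟨hzv, hz⟩)]
    have hCU : C ⊆ insert v (B ∪ D) := by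
      intro z hz
      by_cases hzv : z = v
      · simp [hzv]
      · simp [hCD (Finset.mem_erase.2 ⟨hzv, hz⟩)]
    classical
    have hedge : ∀ F ∈ T, ∀ G ∈ T, v ∈ F → v ∉ G → ∀ x ∈ F ∩ G, ∀ y ∈ F ∩ G, (p x ↔ p y) := by
      intro F hF G hG hvF hvG x hx y hy
      rw [Finset.mem_inter] at hx hy
      by_cases hxy : x = y
      · rw [hxy]
      have hxv : x ≠ v := fun e => hvG (e ▸ hx.2)
      have hyv : y ≠ v := fun e => hvG (e ▸ hy.2)
      refine hp F hF G hG hvF hvG ?_ x (by simp [hxv, hx.1]) y (by simp [hyv, hy.1])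
      rw [erase_eq_pair (hcard F hF) hvF hx.1 hy.1 hxv hyv hxy]
      exact pair_subset hx.2 hy.2
    -- the indicator of the colour on the triangles at `v`, and zero elsewhere
    obtain ⟨g, hg⟩ := exists_potential (hT (insert v (B ∪ D))
        ((Finset.card_insert_le _ _).trans (by omega)))
      (fun F x => if v ∈ F ∧ p x then 1 else 0) (h3 _) (by
        intro F hF G hG x hx y hy
        have hF' := (Finset.mem_filter.1 hF).1
        have hG' := (Finset.mem_filter.1 hG).1
        by_cases hvF : v ∈ F <;> by_cases hvG : v ∈ G
        · simp [hvF, hvG]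
        · simp [hvF, hvG, hedge F hF' G hG' hvF hvG x hx y hy]
        · simp [hvF, hvG, hedge G hG' F hF' hvG hvF x (by rwa [Finset.inter_comm]) y
            (by rwa [Finset.inter_comm])]
        · simp [hvF, hvG])
    have hga := hg A (by simp [hA, hAU]) a haA v hvA
    have hgc := hg C (by simp [hC, hCU]) c hcC v hvC
    have haB : a ∈ B := hAB (Finset.mem_erase.2 ⟨ha.1.1, haA⟩)
    have hcD : c ∈ D := hCD (Finset.mem_erase.2 ⟨hc.1.1, hcC⟩)
    -- Triangles inside `B ∪ D` miss `v` and have zero potential, so `g` is constant there. On `A`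
    -- and `C`, `g` differs from `g v` by the indicator of `p` up to the same constant, so `g a = g
    -- c` forces `p a ↔ p c`.
    have hgac := (color_eq (hT (B ∪ D) (by omega)) (fun x => g x = g a)
      (fun F hF => by rw [h3 _ F hF]; norm_num) (by
        intro F hF x hx y hy
        rw [Finset.mem_filter] at hF
        have hvF : v ∉ F := fun h => by
          have := hF.2 h
          simp [hvB, hvD] at this
        have := hg F (Finset.mem_filter.2 ⟨hF.1, hF.2.trans (Finset.subset_insert _ _)⟩) x hx y hy
        simp only [hvF, false_and, if_false, sub_zero, sub_eq_zero] at this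
        rw [this]) B (by simp [hB]) D (by simp [hD]) a haB c hcD).1 rfl
    by_cases hpa : p a <;> by_cases hpc : p c
    · exact iff_of_true hpa hpc
    · simp only [hvA, hvC, hpa, hpc, and_self, and_false, true_and, if_true, if_false] at hga hgc
      exfalso
      linarith
    · simp only [hvA, hvC, hpa, hpc, and_self, and_false, true_and, if_true, if_false] at hga hgc
      exfalso
      linarith
    · exact iff_of_false hpa hpc
  · intro G hG hvG
    by_contra hno
    push Not at hno
    have hdisj : ∀ F ∈ T, v ∈ F → ∀ x ∈ F, ¬ ∃ B ∈ T, v ∉ B ∧ x ∈ B := by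
      rintro F hF hvF x hx ⟨B, hB, hvB, hxB⟩
      obtain ⟨E, hE, hvE, -, D, hD, hvD, hED⟩ := hnonisol F hF B hB x hx hxB hvF hvB
      exact hno E hE hvE D hD hvD hED
    obtain ⟨y, hy⟩ : G.Nonempty := Finset.card_pos.1 (by rw [hcard G hG]; norm_num)
    refine hdisj F₀ hF₀ hv v hv ((hconn (fun x => ∃ B ∈ T, v ∉ B ∧ x ∈ B) ?_ F₀ hF₀ G hG v hv y
      hy).2 ⟨G, hG, hvG, hy⟩)
    intro F hF x hx z hz
    by_cases hvF : v ∈ F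
    · exact iff_of_false (hdisj F hF hvF x hx) (hdisj F hF hvF z hz)
    · exact iff_of_true ⟨F, hF, hvF, hx⟩ ⟨F, hF, hvF, hz⟩

end Shells

/-! ### The purity condition in terms of pairwise intersections. -/

namespace PreAbstractSimplicialComplex

theorem isAntichain_facets {V : Type*} (S : Set (Finset V)) : IsAntichain (· ⊆ ·) (facets S) :=
  fun _ hF _ hG hne hle => hne (hF.eq_of_le hG.1 hle)

variable {V : Type*} [DecidableEq V]

/-- The shelling condition at one simplex of an antichain, in terms of pairwise intersections. -/
theorem isPureOfDim_inter_closedSimplex_iff {t : ℕ} {F : Fin t → Finset V}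
    (hF : ∀ i j, F i ⊆ F j → i = j) (k : Fin t) (hk : 0 < (k : ℕ)) :
    IsPureOfDim ((⋃ i : Fin t, ⋃ _ : i < k, closedSimplex (F i)) ∩ closedSimplex (F k))
        (simplexDim (F k) - 1) ↔
      ∀ i < k, ∃ j < k, F i ∩ F k ⊆ F j ∧ (F j ∩ F k).card + 1 = (F k).card := by
  have hmem : ∀ G, G ∈ (⋃ i : Fin t, ⋃ _ : i < k, closedSimplex (F i)) ∩ closedSimplex (F k) ↔
      ∃ i < k, G ⊆ F i ∩ F k := by
    intro G
    simp only [closedSimplex, Set.mem_inter_iff, Set.mem_iUnion, Set.mem_ofPred_eq, exists_prop,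
      Finset.subset_inter_iff]
    constructor
    · rintro ⟨⟨i, hi, h⟩, h'⟩
      exact ⟨i, hi, h, h'⟩
    · rintro ⟨i, hi, h, h'⟩
      exact ⟨⟨i, hi, h⟩, h'⟩
  have hlt : ∀ j < k, (F j ∩ F k).card < (F k).card := by
    intro j hj
    refine Finset.card_lt_card (Finset.ssubset_iff_subset_ne.2 ⟨Finset.inter_subset_right, ?_⟩)
    intro e
    exact hj.ne' (hF k j (Finset.inter_eq_right.1 e))
  generalize (⋃ i : Fin t, ⋃ _ : i < k, closedSimplex (F i)) ∩ closedSimplex (F k) = S at hmem ⊢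
  constructor
  · rintro ⟨-, hpure⟩ i hi
    have hfin : S.Finite := by
      refine (F k).powerset.finite_toSet.subset ?_
      intro G hG
      obtain ⟨j, -, hG⟩ := (hmem G).1 hG
      simpa using hG.trans Finset.inter_subset_right
    -- A facet of the intersection has codimension one by purity and lies in some proper `F j ∩ F
    -- k`, so it fills it.
    obtain ⟨G, hle, hG⟩ := hfin.exists_le_maximal ((hmem (F i ∩ F k)).2 ⟨i, hi, subset_rfl⟩)
    obtain ⟨j, hj, hGj⟩ := (hmem G).1 hG.1
    have hd := hpure G hG
    have hc := Finset.card_le_card hGj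
    have hl := hlt j hj
    refine ⟨j, hj, (hle.trans hGj).trans Finset.inter_subset_left, ?_⟩
    simp only [simplexDim] at hd
    omega
  · intro h
    have hdim : ∀ j, (F j ∩ F k).card + 1 = (F k).card →
        simplexDim (F j ∩ F k) = simplexDim (F k) - 1 := by
      intro j hj
      simp only [simplexDim]
      omega
    refine ⟨⟨?_, ?_⟩, ?_⟩
    · obtain ⟨j, hj, -, hc⟩ := h ⟨0, k.pos⟩ (Fin.lt_def.2 hk)
      exact ⟨F j ∩ F k, (hmem _).2 ⟨j, hj, subset_rfl⟩, hdim j hc⟩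
    · rintro _ ⟨G, hG, rfl⟩
      obtain ⟨j, hj, hGj⟩ := (hmem G).1 hG
      have hc := Finset.card_le_card hGj
      have hl := hlt j hj
      simp only [simplexDim]
      omega
    · intro G hG
      obtain ⟨i, hi, hGi⟩ := (hmem G).1 hG.1
      obtain ⟨j, hj, hsub, hc⟩ := h i hi
      have : G ≤ F j ∩ F k :=
        Finset.subset_inter (hGi.trans hsub) (hGi.trans Finset.inter_subset_right)
      rw [hG.eq_of_le ((hmem _).2 ⟨j, hj, subset_rfl⟩) this]
      exact hdim j hc

end PreAbstractSimplicialComplex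

/-! ### Passage between inductive families and enumerations. -/

namespace Shells

variable {V : Type*} [DecidableEq V]

theorem exists_enumeration {S : Finset (Finset V)} (h : Shells S) :
    ∃ (t : ℕ) (F : Fin t → Finset V), Function.Injective F ∧ Set.range F = S ∧
      ∀ k, ∀ i < k, ∃ j < k, F i ∩ F k ⊆ F j ∧ (F j ∩ F k).card + 1 = (F k).card := by
  induction h with
  | empty => exact ⟨0, Fin.elim0, fun i => i.elim0, by simp, fun i => i.elim0⟩
  | @cons S A _ hA hatt ih =>
    obtain ⟨t, F, hinj, hrange, hF⟩ := ih
    have hS : ∀ G, G ∈ S ↔ ∃ i, F i = G := fun G => by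
      rw [← Finset.mem_coe, ← hrange, Set.mem_range]
    refine ⟨t + 1, Fin.snoc F A, ?_, ?_, ?_⟩
    · rw [Fin.snoc_injective_iff]
      exact ⟨hinj, by rwa [hrange, Finset.mem_coe]⟩
    · rw [Fin.range_snoc, hrange, Finset.coe_insert]
    · intro k
      induction k using Fin.lastCases with
      | last =>
        intro i hi
        induction i using Fin.lastCases with
        | last => exact absurd hi (lt_irrefl _)
        | cast i =>
          obtain ⟨G', hG', hsub, hc⟩ := hatt (F i) ((hS _).2 ⟨i, rfl⟩)
          obtain ⟨j, rfl⟩ := (hS G').1 hG'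
          exact ⟨j.castSucc, Fin.castSucc_lt_last j, by simpa using hsub, by simpa using hc⟩
      | cast k =>
        intro i hi
        induction i using Fin.lastCases with
        | last => exact absurd (hi.trans (Fin.castSucc_lt_last k)) (lt_irrefl _)
        | cast i =>
          obtain ⟨j, hj, hsub, hc⟩ := hF k i (Fin.castSucc_lt_castSucc_iff.1 hi)
          exact ⟨j.castSucc, Fin.castSucc_lt_castSucc_iff.2 hj, by simpa using hsub,
            by simpa using hc⟩

theorem of_enumeration {t : ℕ} (F : Fin t → Finset V) (hinj : Function.Injective F)
    (hF : ∀ k, ∀ i < k, ∃ j < k, F i ∩ F k ⊆ F j ∧ (F j ∩ F k).card + 1 = (F k).card) :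
    Shells (Finset.univ.image F) := by
  induction t with
  | zero => simpa using Shells.empty
  | succ t ih =>
    have himage : Finset.univ.image F =
        insert (F (Fin.last t)) (Finset.univ.image (fun i : Fin t => F i.castSucc)) := by
      ext G
      simp [Fin.exists_fin_succ', eq_comm, or_comm]
    rw [himage]
    refine Shells.cons (ih _ (hinj.comp (Fin.castSucc_injective t)) ?_) ?_ ?_
    · intro k i hi
      obtain ⟨j, hj, h⟩ := hF k.castSucc i.castSucc (Fin.castSucc_lt_castSucc_iff.2 hi)
      induction j using Fin.lastCases with
      | last => exact absurd (hj.trans (Fin.castSucc_lt_last k)) (lt_irrefl _)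
      | cast j => exact ⟨j, Fin.castSucc_lt_castSucc_iff.1 hj, h⟩
    · simp only [Finset.mem_image, Finset.mem_univ, true_and, not_exists]
      intro i hi
      exact (Fin.castSucc_lt_last i).ne (hinj hi)
    · simp only [Finset.mem_image, Finset.mem_univ, true_and, forall_exists_index,
        forall_apply_eq_imp_iff, exists_exists_eq_and]
      intro i
      obtain ⟨j, hj, h⟩ := hF (Fin.last t) i.castSucc (Fin.castSucc_lt_last i)
      induction j using Fin.lastCases with
      | last => exact absurd hj (lt_irrefl _)
      | cast j => exact ⟨j, h⟩

end Shells

/-! ### Shellability of complexes in terms of their triangles and edges. -/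

namespace PreAbstractSimplicialComplex

variable {V : Type*} [DecidableEq V]

/-- Facets form an antichain, so purity can be tested on pairwise intersections; at the first facet
the pairwise test is vacuous, matching the exclusion of `k = 0` in `IsShelling`. -/
theorem shellable_iff_shells (K : PreAbstractSimplicialComplex V) {S : Finset (Finset V)}
    (hS : (S : Set (Finset V)) = facets K.faces) : K.Shellable ↔ Shells S := by
  have hanti : ∀ {t : ℕ} {F : Fin t → Finset V}, Function.Injective F →
      Set.range F = facets K.faces → ∀ i j, F i ⊆ F j → i = j := by
    intro t F hinj hrange i j hij
    exact hinj ((isAntichain_facets K.faces).eq (hrange ▸ Set.mem_range_self i)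
      (hrange ▸ Set.mem_range_self j) hij)
  constructor
  · rintro ⟨t, F, hinj, hrange, hF⟩
    have : Finset.univ.image F = S := by
      rw [← Finset.coe_inj, hS, ← hrange]
      simp
    rw [← this]
    refine Shells.of_enumeration F hinj fun k i hi => ?_
    have hk : 0 < (k : ℕ) := (Nat.zero_le _).trans_lt (Fin.lt_def.1 hi)
    exact (isPureOfDim_inter_closedSimplex_iff (hanti hinj hrange) k hk).1 (hF k hk) i hi
  · intro h
    obtain ⟨t, F, hinj, hrange, hF⟩ := h.exists_enumeration
    rw [hS] at hrange
    exact ⟨t, F, hinj, hrange, fun k hk =>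
      (isPureOfDim_inter_closedSimplex_iff (hanti hinj hrange) k hk).2 (hF k)⟩

/-- A finite complex is shellable if its facets of dimension at least two form a shellable family
and its edges form a connected graph. -/
theorem shellable_of_triangles (K : PreAbstractSimplicialComplex V) {S : Finset (Finset V)}
    (hS : (S : Set (Finset V)) = facets K.faces)
    (htri : Shells (S.filter (3 ≤ ·.card)))
    (hconn : ∀ p : V → Prop, (∀ F ∈ S, 2 ≤ F.card → ∀ x ∈ F, ∀ y ∈ F, (p x ↔ p y)) →
      ∀ F ∈ S, ∀ G ∈ S, 2 ≤ F.card → 2 ≤ G.card → ∀ x ∈ F, ∀ y ∈ G, (p x ↔ p y)) :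
    K.Shellable := by
  rw [shellable_iff_shells K hS]
  have hanti : ∀ F ∈ S, ∀ G ∈ S, F ⊆ G → F = G := fun F hF G hG h =>
    (isAntichain_facets K.faces).eq (hS ▸ hF) (hS ▸ hG) h
  have hlt : ∀ F ∈ S, ∀ G ∈ S, F ≠ G → (G ∩ F).card < F.card := by
    intro F hF G hG hne
    refine Finset.card_lt_card (Finset.ssubset_iff_subset_ne.2 ⟨Finset.inter_subset_right, ?_⟩)
    intro e
    exact hne (hanti F hF G hG (Finset.inter_eq_right.1 e))
  have hedges : Shells (S.filter (2 ≤ ·.card)) := by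
    refine Shells.of_forall_exists htri
      (Finset.monotone_filter_right _ fun F _ h => (by norm_num : 2 ≤ 3).trans h) ?_
    intro R hR0 hR1 hRne hR
    by_contra hno
    push Not at hno
    have hRS : ∀ G ∈ R, G ∈ S := fun G hG => (Finset.mem_filter.1 (hR1 hG)).1
    -- An edge facet meets any other facet in at most one vertex, so touching `R` anywhere is enough
    -- to attach it.
    have hstep : ∀ F ∈ S, 2 ≤ F.card → ∀ x ∈ F, (∃ G ∈ R, x ∈ G) → F ∈ R := by
      rintro F hF hF2 x hx ⟨A, hA, hxA⟩
      by_contra hFR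
      have hc2 : F.card = 2 := by
        have h1 : ¬ 3 ≤ F.card := fun h => hFR (hR0 (Finset.mem_filter.2 ⟨hF, h⟩))
        omega
      have hinter : ∀ G ∈ R, ∀ z ∈ G ∩ F, (G ∩ F).card + 1 = F.card := by
        intro G hG z hz
        have h1 := hlt F hF G (hRS G hG) (by rintro rfl; exact hFR hG)
        have h2 : 0 < (G ∩ F).card := Finset.card_pos.2 ⟨z, hz⟩
        omega
      obtain ⟨G, hG, hGno⟩ := hno F (Finset.mem_filter.2 ⟨hF, hF2⟩) hFR
      rcases (G ∩ F).eq_empty_or_nonempty with he | ⟨z, hz⟩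
      · exact hGno A hA (by simp [he]) (hinter A hA x (by simp [hx, hxA]))
      · exact hGno G hG Finset.inter_subset_left (hinter G hG z hz)
    obtain ⟨F, hF, hFR⟩ := Finset.not_subset.1 fun h => hRne (hR1.antisymm h)
    obtain ⟨A, hA, -⟩ := hno F hF hFR
    rw [Finset.mem_filter] at hF
    have hA2 := (Finset.mem_filter.1 (hR1 hA)).2
    obtain ⟨x, hx⟩ : F.Nonempty := Finset.card_pos.1 (by omega)
    obtain ⟨a, ha⟩ : A.Nonempty := Finset.card_pos.1 (by omega)
    refine hFR (hstep F hF.1 hF.2 x hx ((hconn (fun x => ∃ G ∈ R, x ∈ G) ?_ A (hRS A hA) F hF.1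
      hA2 hF.2 a ha x hx).1 ⟨A, hA, ha⟩))
    intro B hB hB2 y hy z hz
    exact ⟨fun h => ⟨B, hstep B hB hB2 y hy h, hz⟩, fun h => ⟨B, hstep B hB hB2 z hz h, hy⟩⟩
  -- Only isolated vertices remain; they meet the rest in the empty face, of dimension -1, as
  -- required.
  refine Shells.of_forall_exists hedges (Finset.filter_subset _ _) ?_
  intro R hR0 hR1 hRne hR
  obtain ⟨F, hF, hFR⟩ := Finset.not_subset.1 fun h => hRne (hR1.antisymm h)
  refine ⟨F, hF, hFR, fun G hG => ⟨G, hG, Finset.inter_subset_left, ?_⟩⟩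
  have h1 := hlt F hF G (hR1 hG) (by rintro rfl; exact hFR hG)
  have h2 : ¬ 2 ≤ F.card := fun h => hFR (hR0 (Finset.mem_filter.2 ⟨hF, h⟩))
  omega

/-- In a shellable finite complex, the faces with three vertices form a shellable family if there
are no larger faces. -/
theorem Shellable.shells_triangles {K : PreAbstractSimplicialComplex V} (hK : K.Shellable)
    (hfin : K.faces.Finite) (hcard : ∀ F ∈ K.faces, F.card ≤ 3) {T : Finset (Finset V)}
    (hT : ∀ F, F ∈ T ↔ F ∈ K.faces ∧ F.card = 3) : Shells T := by
  have hfac : (facets K.faces).Finite := hfin.subset fun F hF => hF.1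
  have h := (shellable_iff_shells K hfac.coe_toFinset).1 hK
  have := h.filter_card (by rw [hfac.coe_toFinset]; exact isAntichain_facets _) 3
  convert this using 1
  ext F
  rw [hT, Finset.mem_filter, Set.Finite.mem_toFinset]
  constructor
  · rintro ⟨hF, h3⟩
    exact ⟨⟨hF, fun G hG hle => (Finset.eq_of_subset_of_card_le hle
      ((hcard G hG).trans h3.ge)).ge⟩, h3.ge⟩
  · rintro ⟨hF, h3⟩
    exact ⟨hF.1, (hcard F hF.1).antisymm h3⟩

/-- A colouring of the vertices of a shellable finite complex which is constant on its edges is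
constant on the vertices lying on edges. -/
theorem Shellable.color_eq {K : PreAbstractSimplicialComplex V} (hK : K.Shellable)
    (hfin : K.faces.Finite) (p : V → Prop)
    (hp : ∀ F ∈ K.faces, 2 ≤ F.card → ∀ x ∈ F, ∀ y ∈ F, (p x ↔ p y)) :
    ∀ F ∈ K.faces, ∀ G ∈ K.faces, 2 ≤ F.card → 2 ≤ G.card →
      ∀ x ∈ F, ∀ y ∈ G, (p x ↔ p y) := by
  intro F hF G hG hF2 hG2 x hx y hy
  have hfac : (facets K.faces).Finite := hfin.subset fun F hF => hF.1
  have h := (shellable_iff_shells K hfac.coe_toFinset).1 hK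
  have h2 := h.filter_card (by rw [hfac.coe_toFinset]; exact isAntichain_facets _) 2
  obtain ⟨F', hFF', hF'⟩ := hfin.exists_le_maximal hF
  obtain ⟨G', hGG', hG'⟩ := hfin.exists_le_maximal hG
  refine h2.color_eq p (fun A hA => (Finset.mem_filter.1 hA).2) (fun A hA => ?_)
    F' ?_ G' ?_ x (hFF' hx) y (hGG' hy)
  · rw [Finset.mem_filter, Set.Finite.mem_toFinset] at hA
    exact hp A hA.1.1 hA.2
  · rw [Finset.mem_filter, Set.Finite.mem_toFinset]
    exact ⟨hF', hF2.trans (Finset.card_le_card hFF')⟩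
  · rw [Finset.mem_filter, Set.Finite.mem_toFinset]
    exact ⟨hG', hG2.trans (Finset.card_le_card hGG')⟩

end PreAbstractSimplicialComplex

/-! ### The main theorem. -/

theorem corollary4 {V : Type*} (K : PreAbstractSimplicialComplex V)
    (hfin : K.faces.Finite)
    (hdim : PreAbstractSimplicialComplex.HasDim K.faces 2)
    (hK : ¬ K.Shellable) :
    ∃ U : Finset V, (U : Set V) ⊆ K.vertexSet ∧ 4 ≤ U.card ∧ U.card ≤ 7 ∧
      ¬ (K.induced U).Shellable := by
  classical
  by_contra! hU
  have hcard : ∀ F ∈ K.faces, F.card ≤ 3 := by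
    intro F hF
    have := hdim.2 ⟨F, hF, rfl⟩
    simp only [PreAbstractSimplicialComplex.simplexDim] at this
    omega
  have hvert : ∀ F ∈ K.faces, ∀ x ∈ F, x ∈ K.vertexSet := fun F hF x hx =>
    (K.isRelLowerSet_faces hF).2 (Finset.singleton_subset_iff.2 hx) (Finset.singleton_nonempty x)
  have hind : ∀ U, (K.induced U).faces.Finite := fun U => hfin.subset fun F hF => hF.1
  set T := hfin.toFinset.filter (·.card = 3) with hT
  have memT : ∀ F, F ∈ T ↔ F ∈ K.faces ∧ F.card = 3 := fun F => by simp [hT]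
  have hshell : Shells T := by
    refine Shells.of_restrict (fun F hF => ((memT F).1 hF).2) fun U hU7 => ?_
    -- The criterion quantifies over arbitrary `U`, the hypothesis only over sets of vertices of
    -- `K`; discarding non-vertices loses no triangle.
    set W := U.filter (· ∈ K.vertexSet) with hW
    have hTW : T.filter (· ⊆ U) = T.filter (· ⊆ W) := by
      refine Finset.filter_congr fun F hF => ⟨fun h x hx => ?_,
        fun h => h.trans (Finset.filter_subset _ _)⟩
      exact Finset.mem_filter.2 ⟨h hx, hvert F ((memT F).1 hF).1 x hx⟩
    rw [hTW]
    by_cases hW4 : 4 ≤ W.card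
    · have hsh := hU W (fun x hx => (Finset.mem_filter.1 hx).2) hW4
        ((Finset.card_le_card (Finset.filter_subset _ _)).trans hU7)
      refine hsh.shells_triangles (hind W) (fun F hF => hcard F hF.1) fun F => ?_
      rw [Finset.mem_filter, memT]
      exact and_right_comm
    · exact Shells.filter_subset_of_card_le (fun F hF => ((memT F).1 hF).2) (by omega)
  have hfac : (PreAbstractSimplicialComplex.facets K.faces).Finite := hfin.subset fun F hF => hF.1
  refine hK (K.shellable_of_triangles hfac.coe_toFinset ?_ ?_)
  · convert hshell using 1
    ext F
    rw [memT, Finset.mem_filter, Set.Finite.mem_toFinset]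
    constructor
    · rintro ⟨hF, h3⟩
      exact ⟨hF.1, (hcard F hF.1).antisymm h3⟩
    · rintro ⟨hF, h3⟩
      exact ⟨⟨hF, fun G hG hle => (Finset.eq_of_subset_of_card_le hle
        ((hcard G hG).trans h3.ge)).ge⟩, h3.ge⟩
  · intro p hp F hF G hG hF2 hG2 x hx y hy
    rw [Set.Finite.mem_toFinset] at hF hG
    by_contra hxy
    have hp' : ∀ A ∈ K.faces, 2 ≤ A.card → ∀ x ∈ A, ∀ y ∈ A, (p x ↔ p y) := by
      intro A hA hA2 x hx y hy
      obtain ⟨B, hAB, hB⟩ := hfin.exists_le_maximal hA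
      exact hp B ((hfac.mem_toFinset).2 hB) (hA2.trans (Finset.card_le_card hAB)) x (hAB hx) y
        (hAB hy)
    -- Faces of different colours are disjoint, so together they have between 2 + 2 and 3 + 3
    -- vertices, within the allowed range.
    have hdisj : Disjoint F G := by
      rw [Finset.disjoint_left]
      intro z hzF hzG
      exact hxy ((hp' F hF.1 hF2 x hx z hzF).trans (hp' G hG.1 hG2 z hzG y hy))
    have hc := Finset.card_union_of_disjoint hdisj
    have hF3 := hcard F hF.1
    have hG3 := hcard G hG.1
    have hsh := hU (F ∪ G) (fun z hz => by
      rcases Finset.mem_union.1 hz with hz | hz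
      · exact hvert F hF.1 z hz
      · exact hvert G hG.1 z hz) (by omega) (by omega)
    exact hxy (hsh.color_eq (hind _) p (fun A hA => hp' A hA.1) F
      ⟨hF.1, Finset.subset_union_left⟩ G ⟨hG.1, Finset.subset_union_right⟩ hF2 hG2 x hx y hy)
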